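/- Let $\mathbb{F}$ be a division ring, $\sigma : \mathbb{F} \to \mathbb{F}^{n \times n}$ a (unital) ring morphism and $\delta : \mathbb{F} \to \mathbb{F}^n$ a $\sigma$-derivation, that is, an additive map with $\delta(bc) = \sigma(b)\delta(c) + \delta(b)c$ for all $b,c \in \mathbb{F}$. Let $R = \mathbb{F}[\mathbf{x};\sigma,\delta]$ be the free multivariate skew polynomial ring: the left $\mathbb{F}$-vector space whose basis is the free monoid $\mathcal{M}$ on the letters $x_1,\ldots,x_n$, with the product given by appending monomials and by the rule $x_i b = \sum_{j=1}^n \sigma_{i,j}(b) x_j + \delta_i(b)$ for $b \in \mathbb{F}$. Fix $\mathbf{a} \in \mathbb{F}^n$. Define $\mathcal{D}_{\mathbf{a}} = (\mathcal{D}_{\mathbf{a}}^{x_1},\ldots,\mathcal{D}_{\mathbf{a}}^{x_n}) : \mathbb{F} \to \mathbb{F}^n$ by $\mathcal{D}_{\mathbf{a}}(\beta) = \sigma(\beta)\mathbf{a} + \delta(\beta)$, and operators $\mathcal{D}_{\mathbf{a}}^{\mathfrak{m}} : \mathbb{F} \to \mathbb{F}$ for $\mathfrak{m} \in \mathcal{M}$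 by $\mathcal{D}_{\mathbf{a}}^1 = \mathrm{Id}$ and $\mathcal{D}_{\mathbf{a}}^{x_i \mathfrak{m}} = \mathcal{D}_{\mathbf{a}}^{x_i} \circ \mathcal{D}_{\mathbf{a}}^{\mathfrak{m}}$. Let $\mathbb{F}[\mathcal{D}_{\mathbf{a}}]$ be the left $\mathbb{F}$-vector space of operators spanned by all $\mathcal{D}_{\mathbf{a}}^{\mathfrak{m}}$, with composition $\circ$ as product, and for $F = \sum_{\mathfrak{m}} F_{\mathfrak{m}} \mathfrak{m} \in R$ put $F^{\mathcal{D}_{\mathbf{a}}} = \sum_{\mathfrak{m}} F_{\mathfrak{m}} \mathcal{D}_{\mathbf{a}}^{\mathfrak{m}}$. Let $K_{\mathbf{a}} = \{\beta \in \mathbb{F} : \mathcal{D}_{\mathbf{a}}(\beta) = \mathbf{a}\beta\}$, a division subring of $\mathbb{F}$, let $\mathcal{C}(\mathbf{a}) = \{\mathcal{D}_{\mathbf{a}}(\beta)\beta^{-1} : \beta \in \mathbb{F}\setminus\{0\}\}$, and let $I(\mathcal{C}(\mathbf{a}))$ be the (two-sided) ideal of all $F \in R$ with $F(\mathbf{b})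 = 0$ for all $\mathbf{b} \in \mathcal{C}(\mathbf{a})$, where $F(\mathbf{b})$ is the unique element of $\mathbb{F}$ such that $F - F(\mathbf{b})$ lies in the left ideal $(x_1 - b_1,\ldots,x_n - b_n)$. Suppose that $M = \dim^R_{K_{\mathbf{a}}}(\mathbb{F})$, the dimension of $\mathbb{F}$ as a right vector space over $K_{\mathbf{a}}$, is finite, and let $\boldsymbol\beta = (\beta_1,\ldots,\beta_M)$ be an ordered right basis of $\mathbb{F}$ over $K_{\mathbf{a}}$. For $\mathbf{y} = (y_1,\ldots,y_M) \in \mathbb{F}^M$ let $\mu_{\boldsymbol\beta}(\mathbf{y}) \in K_{\mathbf{a}}^{M \times M}$ be the matrix $(y_j^i)_{i,j}$ determined by $y_j = \sum_{i=1}^M \beta_i y_j^i$, and put $\mathbf{y} \star_{\boldsymbol\beta} \mathbf{z} = \mu_{\boldsymbol\beta}^{-1}(\mu_{\boldsymbol\beta}(\mathbf{y})\mu_{\boldsymbol\beta}(\mathbf{z}))$. Then: 1. $F + I(\mathcal{C}(\mathbf{a})) \mapsto F^{\mathcal{D}_{\mathbf{a}}}$ is a well-defined left $\mathbb{F}$-linear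 ring isomorphism $R/I(\mathcal{C}(\mathbf{a})) \to (\mathbb{F}[\mathcal{D}_{\mathbf{a}}],\circ)$. 2. $E^L_{\boldsymbol\beta} : f \mapsto (f(\beta_1),\ldots,f(\beta_M))$ is a left $\mathbb{F}$-linear ring isomorphism $(\mathbb{F}[\mathcal{D}_{\mathbf{a}}],\circ) \to (\mathbb{F}^M,\star_{\boldsymbol\beta})$. 3. $\mu_{\boldsymbol\beta} : (\mathbb{F}^M,\star_{\boldsymbol\beta}) \to K_{\mathbf{a}}^{M \times M}$ is a ring isomorphism; hence so is $\mu_{\boldsymbol\beta} \circ E^L_{\boldsymbol\beta} : \mathbb{F}[\mathcal{D}_{\mathbf{a}}] \to K_{\mathbf{a}}^{M \times M}$. 4. The ring $R/I(\mathcal{C}(\mathbf{a}))$ is simple: it is non-zero and has no two-sided ideals other than $0$ and itself. -/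

import Mathlib

open scoped Matrix

noncomputable section

/-- A `σ`-derivation `δ : F → Fⁿ`, for a ring morphism `σ : F → F^{n × n}`: an additive map with
`δ (a b) = σ(a) δ(b) + δ(a) b`. -/
structure SkewDerivation {F : Type*} [DivisionRing F] {n : ℕ}
    (σ : F →+* Matrix (Fin n) (Fin n) F) where
  toFun : F → Fin n → F
  map_add' : ∀ a b, toFun (a + b) = toFun a + toFun b
  map_mul' : ∀ a b, toFun (a * b) = σ a *ᵥ toFun b + fun i => toFun a i * b

namespace SkewDerivation

variable {F : Type*} [DivisionRing F] {n : ℕ} {σ : F →+* Matrix (Fin n) (Fin n) F}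

instance : CoeFun (SkewDerivation σ) (fun _ => F → Fin n → F) := ⟨SkewDerivation.toFun⟩

variable (δ : SkewDerivation σ)

theorem map_add (a b : F) : δ (a + b) = δ a + δ b := δ.map_add' a b

theorem map_zero : δ 0 = 0 := by
  have h := δ.map_add 0 0
  simpa using h

theorem map_mul_apply (a b : F) (i : Fin n) :
    δ (a * b) i = ∑ k, σ a i k * δ b k + δ a i * b := by
  rw [δ.map_mul']; simp [Matrix.mulVec, dotProduct]

theorem map_one : δ 1 = 0 := by
  have h := δ.map_mul' 1 1
  simpa using h

end SkewDerivation

section EndApply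

variable {V : Type*} [AddCommGroup V]

theorem addEnd_add_apply (f g : AddMonoid.End V) (v : V) : (f + g) v = f v + g v := rfl

theorem addEnd_sub_apply (f g : AddMonoid.End V) (v : V) : (f - g) v = f v - g v := rfl

theorem addEnd_mul_apply (f g : AddMonoid.End V) (v : V) : (f * g) v = f (g v) := rfl

theorem addEnd_sum_apply {ι : Type*} (s : Finset ι) (f : ι → AddMonoid.End V) (v : V) :
    (∑ i ∈ s, f i) v = ∑ i ∈ s, f i v := by
  classical
  induction s using Finset.induction_on with
  | empty => rfl
  | insert i s hi ih => rw [Finset.sum_insert hi, Finset.sum_insert hi, addEnd_add_apply, ih]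

theorem scalarEnd_apply {R : Type*} [Ring R] [Module R V] (c : R) (v : V) :
    Module.toAddMonoidEnd R V c v = c • v := rfl

end EndApply

/-- The free multivariate skew polynomial ring `F[x; σ, δ]`: the left vector space over `F` with
basis the free monoid on `n` letters; its product is defined below. -/
def SkewPoly {F : Type*} [DivisionRing F] {n : ℕ} {σ : F →+* Matrix (Fin n) (Fin n) F}
    (_δ : SkewDerivation σ) : Type _ :=
  FreeMonoid (Fin n) →₀ F

namespace SkewPoly

variable {F : Type*} [DivisionRing F] {n : ℕ} {σ : F →+* Matrix (Fin n) (Fin n) F}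
  (δ : SkewDerivation σ)

instance : AddCommGroup (SkewPoly δ) := inferInstanceAs (AddCommGroup (FreeMonoid (Fin n) →₀ F))

instance : Module F (SkewPoly δ) := inferInstanceAs (Module F (FreeMonoid (Fin n) →₀ F))

/-- The skew polynomial `c 𝔪`, for a constant `c` and a monomial `𝔪`. -/
def monomial (m : FreeMonoid (Fin n)) : F →+ SkewPoly δ := Finsupp.singleAddHom m

variable {δ} in
theorem induction_on {p : SkewPoly δ → Prop} (G : SkewPoly δ) (zero : p 0)
    (add : ∀ G H, p G → p H → p (G + H)) (mono : ∀ m c, p (monomial δ m c)) : p G :=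
  Finsupp.induction_linear G zero add mono

theorem smul_monomial (c d : F) (m : FreeMonoid (Fin n)) :
    c • monomial δ m d = monomial δ m (c * d) :=
  Finsupp.smul_single c m d

/-- The additive map `∑ c_𝔪 𝔪 ↦ ∑ s(c_𝔪) y_𝔪` into a ring `A`, where `s : F → A` is a ring morphism
and `y_𝔪` is the product of the `y i` along the word `𝔪`. -/
def sumMap {A : Type*} [Ring A] (s : F →+* A) (y : Fin n → A) : SkewPoly δ →+ A :=
  Finsupp.liftAddHom fun m => (AddMonoidHom.mulRight (FreeMonoid.lift y m)).comp s.toAddMonoidHom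

theorem sumMap_monomial {A : Type*} [Ring A] (s : F →+* A) (y : Fin n → A)
    (m : FreeMonoid (Fin n)) (c : F) :
    sumMap δ s y (monomial δ m c) = s c * FreeMonoid.lift y m := by
  unfold sumMap monomial
  exact Finsupp.liftAddHom_apply_single _ _ _

/-- Left multiplication by the variable `x_i`, according to the rule
`x_i (c 𝔪) = ∑ j, σ_{i,j}(c) x_j 𝔪 + δ_i(c) 𝔪`. -/
def varMul (i : Fin n) : AddMonoid.End (SkewPoly δ) :=
  Finsupp.liftAddHom fun m =>
    { toFun := fun c => ∑ j, monomial δ (FreeMonoid.of j * m) (σ c i j) + monomial δ m (δ c i)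
      map_zero' := by simp [δ.map_zero]
      map_add' := fun c d => by
        simp only [_root_.map_add, Matrix.add_apply, δ.map_add, Pi.add_apply,
          Finset.sum_add_distrib]
        abel }

theorem varMul_monomial (i : Fin n) (m : FreeMonoid (Fin n)) (c : F) :
    varMul δ i (monomial δ m c) =
      ∑ j, monomial δ (FreeMonoid.of j * m) (σ c i j) + monomial δ m (δ c i) := by
  unfold varMul
  exact Finsupp.liftAddHom_apply_single _ _ _

/-- Left multiplication by a skew polynomial: `∑ c_𝔪 𝔪` acts as `∑ c_𝔪 (x_{i_1} ∘ ⋯ ∘ x_{i_d})` for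
`𝔪 = x_{i_1} ⋯ x_{i_d}`. -/
def mulHom : SkewPoly δ →+ AddMonoid.End (SkewPoly δ) :=
  sumMap δ (Module.toAddMonoidEnd F (SkewPoly δ)) (varMul δ)

section general

variable {A : Type*} [Ring A] (s : F →+* A) (y : Fin n → A)

theorem sumMap_smul (c : F) (G : SkewPoly δ) : sumMap δ s y (c • G) = s c * sumMap δ s y G := by
  induction G using induction_on with
  | zero => simp
  | add G H hG hH => simp [mul_add, hG, hH]
  | mono m d => simp [smul_monomial, sumMap_monomial, mul_assoc]

theorem sumMap_varMul
    (hy : ∀ i c, y i * s c = ∑ j, s (σ c i j) * y j + s (δ c i)) (i : Fin n) (G : SkewPoly δ) :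
    sumMap δ s y (varMul δ i G) = y i * sumMap δ s y G := by
  induction G using induction_on with
  | zero => simp
  | add G H hG hH => simp [mul_add, hG, hH]
  | mono m d =>
    simp [varMul_monomial, sumMap_monomial, ← mul_assoc, hy, add_mul, Finset.sum_mul]

theorem sumMap_word
    (hy : ∀ i c, y i * s c = ∑ j, s (σ c i j) * y j + s (δ c i)) (m : FreeMonoid (Fin n))
    (G : SkewPoly δ) :
    sumMap δ s y (FreeMonoid.lift (varMul δ) m G) = FreeMonoid.lift y m * sumMap δ s y G := by
  induction m using FreeMonoid.inductionOn' with
  | one => simp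
  | of_mul i m ih => simp [sumMap_varMul δ s y hy, ih, mul_assoc, addEnd_mul_apply]

theorem sumMap_mulHom
    (hy : ∀ i c, y i * s c = ∑ j, s (σ c i j) * y j + s (δ c i)) (G H : SkewPoly δ) :
    sumMap δ s y (mulHom δ G H) = sumMap δ s y G * sumMap δ s y H := by
  induction G using induction_on with
  | zero => simp
  | add G G' hG hG' => simp [add_mul, hG, hG', addEnd_add_apply]
  | mono m d =>
    simp [mulHom, sumMap_monomial, sumMap_smul, sumMap_word δ s y hy, mul_assoc,
      addEnd_mul_apply, scalarEnd_apply]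

end general

theorem varMul_smul (i : Fin n) (c : F) (G : SkewPoly δ) :
    varMul δ i (c • G) = ∑ j, σ c i j • varMul δ j G + δ c i • G := by
  induction G using induction_on with
  | zero => simp
  | add G H hG hH =>
    simp only [smul_add, _root_.map_add, hG, hH, Finset.sum_add_distrib]
    abel
  | mono m d =>
    simp only [smul_monomial, varMul_monomial, _root_.map_mul, Matrix.mul_apply, δ.map_mul_apply,
      smul_add, Finset.smul_sum, _root_.map_sum, _root_.map_add, Finset.sum_add_distrib]
    rw [Finset.sum_comm, add_assoc]

theorem varMul_rule (i : Fin n) (c : F) :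
    varMul δ i * Module.toAddMonoidEnd F (SkewPoly δ) c =
      ∑ j, Module.toAddMonoidEnd F (SkewPoly δ) (σ c i j) * varMul δ j
        + Module.toAddMonoidEnd F (SkewPoly δ) (δ c i) := by
  apply AddMonoid.End.ext
  intro G
  simp [addEnd_mul_apply, addEnd_add_apply, addEnd_sum_apply, scalarEnd_apply, varMul_smul]

instance : Mul (SkewPoly δ) := ⟨fun G H => mulHom δ G H⟩

instance : One (SkewPoly δ) := ⟨monomial δ 1 1⟩

theorem mul_def (G H : SkewPoly δ) : G * H = mulHom δ G H := rfl

theorem one_def : (1 : SkewPoly δ) = monomial δ 1 1 := rfl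

theorem word_one (m : FreeMonoid (Fin n)) :
    FreeMonoid.lift (varMul δ) m (1 : SkewPoly δ) = monomial δ m 1 := by
  induction m using FreeMonoid.inductionOn' with
  | one => rfl
  | of_mul i m ih =>
    simp only [_root_.map_mul, FreeMonoid.lift_eval_of, addEnd_mul_apply, ih,
      varMul_monomial, _root_.map_one, δ.map_one, Pi.zero_apply, _root_.map_zero, add_zero]
    rw [Finset.sum_eq_single i] <;> simp +contextual [eq_comm]

instance : Ring (SkewPoly δ) :=
  { (inferInstance : AddCommGroup (SkewPoly δ)) with
    mul := (· * ·)
    one := 1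
    left_distrib := fun G H K => by simp [mul_def]
    right_distrib := fun G H K => by simp [mul_def, addEnd_add_apply]
    zero_mul := fun G => by simp [mul_def]
    mul_zero := fun G => by simp [mul_def]
    mul_assoc := fun G H K => by
      have h := sumMap_mulHom δ (Module.toAddMonoidEnd F (SkewPoly δ)) (varMul δ)
        (varMul_rule δ) G H
      exact DFunLike.congr_fun h K
    one_mul := fun G => by simp [mul_def, one_def, mulHom, sumMap_monomial]
    mul_one := fun G => by
      change mulHom δ G 1 = G
      induction G using induction_on with
      | zero => simp
      | add G H hG hH => simp [addEnd_add_apply, hG, hH]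
      | mono m d =>
        simp [mulHom, sumMap_monomial, word_one, smul_monomial, addEnd_mul_apply,
          scalarEnd_apply] }

instance : IsScalarTower F (SkewPoly δ) (SkewPoly δ) :=
  ⟨fun c G H => by
    simp [mul_def, mulHom, sumMap_smul, addEnd_mul_apply, scalarEnd_apply]⟩

/-- The variable `x_i`. -/
def X (i : Fin n) : SkewPoly δ := monomial δ (FreeMonoid.of i) 1

/-- The constant skew polynomial `c`. -/
def C (c : F) : SkewPoly δ := monomial δ 1 c

theorem smul_one_eq (c : F) : c • (1 : SkewPoly δ) = C δ c := by
  simp [one_def, C, smul_monomial]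

theorem C_mul (c : F) (G : SkewPoly δ) : C δ c * G = c • G := by
  rw [← smul_one_eq, smul_mul_assoc, one_mul]

theorem X_mul (i : Fin n) (G : SkewPoly δ) : X δ i * G = varMul δ i G := by
  simp [X, mul_def, mulHom, sumMap_monomial]

/-- Products of monomials are given by appending them. -/
theorem monomial_mul_monomial (m m' : FreeMonoid (Fin n)) :
    monomial δ m 1 * monomial δ m' 1 = monomial δ (m * m') 1 := by
  simp only [← word_one δ m', ← word_one δ (m * m'), _root_.map_mul, addEnd_mul_apply]
  simp [mul_def, mulHom, sumMap_monomial]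

/-- The defining commutation rule `x_i c = ∑ j, σ_{i,j}(c) x_j + δ_i(c)`. -/
theorem X_mul_C (i : Fin n) (c : F) :
    X δ i * C δ c = ∑ j, C δ (σ c i j) * X δ j + C δ (δ c i) := by
  simp only [C_mul, X_mul]
  simp [C, varMul_monomial, X, smul_monomial]

/-- The operators `𝒟_a^{x_i} : F → F`, the components of `𝒟_a(β) = σ(β) a + δ(β)`. -/
def opD (a : Fin n → F) (i : Fin n) : AddMonoid.End F where
  toFun b := (σ b *ᵥ a + δ b) i
  map_zero' := by simp [δ.map_zero]
  map_add' b c := by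
    simp only [_root_.map_add, δ.map_add, Matrix.add_mulVec, Pi.add_apply]
    abel

theorem opD_apply (a : Fin n → F) (i : Fin n) (b : F) :
    opD δ a i b = ∑ j, σ b i j * a j + δ b i := rfl

/-- The operator `𝒟_a^𝔪`, with `𝒟_a^1 = Id` and `𝒟_a^{x_i 𝔪} = 𝒟_a^{x_i} ∘ 𝒟_a^𝔪`. The product in
`AddMonoid.End F` is composition of maps. -/
def opWord (a : Fin n → F) : FreeMonoid (Fin n) →* AddMonoid.End F := FreeMonoid.lift (opD δ a)

/-- The map `φ_a`, sending `∑ c_𝔪 𝔪` to the operator `β ↦ ∑ c_𝔪 𝒟_a^𝔪(β)`. -/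
def linearize (a : Fin n → F) : SkewPoly δ →+ AddMonoid.End F :=
  sumMap δ (Module.toAddMonoidEnd F F) (opD δ a)

theorem linearize_monomial (a : Fin n → F) (m : FreeMonoid (Fin n)) (c b : F) :
    linearize δ a (monomial δ m c) b = c * opWord δ a m b := by
  simp [linearize, sumMap_monomial, opWord, addEnd_mul_apply, scalarEnd_apply]

theorem linearize_apply (a : Fin n → F) (G : SkewPoly δ) (b : F) :
    linearize δ a G b = Finsupp.sum G fun m c => c * opWord δ a m b := by
  induction G using induction_on with
  | zero => exact (Finsupp.sum_zero_index).symm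
  | add G H hG hH =>
    rw [_root_.map_add, addEnd_add_apply, hG, hH]
    exact (Finsupp.sum_add_index' (by simp) (by simp [add_mul])).symm
  | mono m c =>
    rw [linearize_monomial]
    exact (Finsupp.sum_single_index (h := fun m c => c * opWord δ a m b) (zero_mul _)).symm

theorem opD_mul (a : Fin n → F) (i : Fin n) (c b : F) :
    opD δ a i (c * b) = ∑ j, σ c i j * opD δ a j b + δ c i * b := by
  simp only [opD_apply, _root_.map_mul, Matrix.mul_apply, δ.map_mul_apply, mul_add,
    Finset.sum_add_distrib, Finset.mul_sum, Finset.sum_mul]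
  rw [Finset.sum_comm, add_assoc]
  simp [mul_assoc]

theorem linearize_mul (a : Fin n → F) (G H : SkewPoly δ) :
    linearize δ a (G * H) = linearize δ a G * linearize δ a H := by
  refine sumMap_mulHom δ _ _ (fun i c => ?_) G H
  apply AddMonoid.End.ext
  intro b
  simp [addEnd_mul_apply, addEnd_add_apply, addEnd_sum_apply, scalarEnd_apply, opD_mul]

theorem linearize_C (a : Fin n → F) (c b : F) : linearize δ a (C δ c) b = c * b := by
  simp [C, linearize_monomial]

theorem linearize_X (a : Fin n → F) (i : Fin n) : linearize δ a (X δ i) = opD δ a i := by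
  apply AddMonoid.End.ext
  intro b
  rw [X, linearize_monomial]
  simp [opWord]

/-- The left ideal `(x_1 - a_1, …, x_n - a_n)`. -/
def pointIdeal (a : Fin n → F) : Ideal (SkewPoly δ) :=
  Ideal.span (Set.range fun i => X δ i - C δ (a i))

theorem opD_one (a : Fin n → F) (i : Fin n) : opD δ a i 1 = a i := by
  simp [opD_apply, δ.map_one, Matrix.one_apply]

theorem linearize_one_of_mem (a : Fin n → F) {G : SkewPoly δ} (hG : G ∈ pointIdeal δ a) :
    linearize δ a G 1 = 0 := by
  induction hG using Submodule.span_induction with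
  | mem x hx =>
    obtain ⟨i, rfl⟩ := hx
    simp [linearize_X, linearize_C, opD_one, addEnd_sub_apply]
  | zero => simp
  | add x y _ _ hx hy => simp [hx, hy, addEnd_add_apply]
  | smul r x _ hx => simp [linearize_mul, hx, addEnd_mul_apply]

theorem smul_mem_of_mem {I : Ideal (SkewPoly δ)} (c : F) {G : SkewPoly δ} (hG : G ∈ I) :
    c • G ∈ I := by
  rw [← C_mul]; exact I.mul_mem_left _ hG

theorem sub_linearize_word_mem (a : Fin n → F) (m : FreeMonoid (Fin n)) :
    monomial δ m 1 - C δ (opWord δ a m 1) ∈ pointIdeal δ a := by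
  induction m using FreeMonoid.inductionOn' with
  | one => simp [C]
  | of_mul i m ih =>
    set b := opWord δ a m 1 with hb
    have e1 : monomial δ (FreeMonoid.of i * m) 1 = X δ i * monomial δ m 1 :=
      (monomial_mul_monomial δ _ _).symm
    have e2 : opWord δ a (FreeMonoid.of i * m) 1 = opD δ a i b := by simp [hb, opWord]
    have e3 : monomial δ (FreeMonoid.of i * m) 1 - C δ (opD δ a i b) =
        X δ i * (monomial δ m 1 - C δ b) + ∑ j, σ b i j • (X δ j - C δ (a j)) := by
      rw [e1, mul_sub, X_mul_C, opD_apply]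
      simp only [C, _root_.map_add, _root_.map_sum, smul_sub, smul_monomial,
        Finset.sum_sub_distrib]
      simp only [← C.eq_def, C_mul]
      abel
    rw [e2, e3]
    exact add_mem (Ideal.mul_mem_left _ _ ih) (sum_mem fun j _ =>
      smul_mem_of_mem δ _ (Ideal.subset_span ⟨j, rfl⟩))

theorem sub_linearize_mem (a : Fin n → F) (G : SkewPoly δ) :
    G - C δ (linearize δ a G 1) ∈ pointIdeal δ a := by
  induction G using induction_on with
  | zero => simp [C]
  | add G H hG hH =>
    have h := add_mem hG hH
    convert h using 1
    simp only [C, _root_.map_add, addEnd_add_apply]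
    abel
  | mono m c =>
    have h := smul_mem_of_mem δ c (sub_linearize_word_mem δ a m)
    simpa [linearize_monomial, smul_sub, C, smul_monomial] using h

theorem existsUnique_eval (a : Fin n → F) (G : SkewPoly δ) :
    ∃! b : F, G - C δ b ∈ pointIdeal δ a := by
  refine ⟨_, sub_linearize_mem δ a G, fun b hb => ?_⟩
  have h := linearize_one_of_mem δ a hb
  simp [linearize_C, sub_eq_zero, addEnd_sub_apply] at h
  exact h.symm

/-- The skew evaluation `G(a)`: the unique `b ∈ F` with `G - b ∈ (x_1 - a_1, …, x_n - a_n)`. -/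
def eval (a : Fin n → F) (G : SkewPoly δ) : F := (existsUnique_eval δ a G).choose

theorem eval_eq_linearize (a : Fin n → F) (G : SkewPoly δ) :
    eval δ a G = linearize δ a G 1 :=
  (existsUnique_eval δ a G).unique (existsUnique_eval δ a G).choose_spec.1
    (sub_linearize_mem δ a G)

/-- The left ideal `I(Ω)` of skew polynomials vanishing at all points of `Ω`. -/
def vanishingIdeal (Ω : Set (Fin n → F)) : Ideal (SkewPoly δ) where
  carrier := {G | ∀ a ∈ Ω, eval δ a G = 0}
  zero_mem' a _ := by simp [eval_eq_linearize]
  add_mem' hG hH a ha := by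
    have h1 := hG a ha
    have h2 := hH a ha
    simp only [eval_eq_linearize] at h1 h2 ⊢
    simp [h1, h2, addEnd_add_apply]
  smul_mem' G H hH a ha := by
    have h2 := hH a ha
    simp only [eval_eq_linearize] at h2 ⊢
    simp [linearize_mul, h2, addEnd_mul_apply]

/-- The conjugate `a^b = 𝒟_a(b) b⁻¹`. -/
def conj (a : Fin n → F) (b : F) : Fin n → F := fun i => opD δ a i b * b⁻¹

/-- The conjugacy class `𝒞(a) = {𝒟_a(b) b⁻¹ | b ∈ F*}`. -/
def conjClass (a : Fin n → F) : Set (Fin n → F) := {c | ∃ b : F, b ≠ 0 ∧ c = conj δ a b}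

theorem opD_conj (a : Fin n → F) {b : F} (hb : b ≠ 0) (i : Fin n) (c : F) :
    opD δ (conj δ a b) i c * b = opD δ a i (c * b) := by
  rw [opD_mul, opD_apply, add_mul, Finset.sum_mul]
  simp [conj, mul_assoc, hb]

theorem linearize_conj (a : Fin n → F) {b : F} (hb : b ≠ 0) (G : SkewPoly δ) (c : F) :
    linearize δ (conj δ a b) G c * b = linearize δ a G (c * b) := by
  have hw : ∀ m, opWord δ (conj δ a b) m c * b = opWord δ a m (c * b) := by
    intro m
    induction m using FreeMonoid.inductionOn' with
    | one => simp
    | of_mul i m ih =>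
      have h := opD_conj δ a hb i (opWord δ (conj δ a b) m c)
      simp only [opWord, _root_.map_mul, FreeMonoid.lift_eval_of, addEnd_mul_apply] at *
      rw [h, ih]
  simp only [linearize_apply, Finsupp.sum, Finset.sum_mul, mul_assoc, hw]

theorem mem_vanishingIdeal_conjClass (a : Fin n → F) (G : SkewPoly δ) :
    G ∈ vanishingIdeal δ (conjClass δ a) ↔ linearize δ a G = 0 := by
  constructor
  · intro h
    apply AddMonoid.End.ext
    intro b
    by_cases hb : b = 0
    · simp [hb]
    · have h1 := h _ ⟨b, hb, rfl⟩
      rw [eval_eq_linearize] at h1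
      have h2 := linearize_conj δ a hb G 1
      rw [h1, zero_mul, one_mul] at h2
      simpa using h2.symm
  · rintro h _ ⟨b, hb, rfl⟩
    have h2 := linearize_conj δ a hb G 1
    rw [h] at h2
    rw [eval_eq_linearize]
    simpa [hb] using h2

/-- `I(𝒞(a))` is a two-sided ideal, so that the quotient by it is a ring. -/
instance (a : Fin n → F) : (vanishingIdeal δ (conjClass δ a)).IsTwoSided :=
  ⟨fun H hG => by
    rw [mem_vanishingIdeal_conjClass] at *
    rw [linearize_mul, hG, zero_mul]⟩

theorem linearize_mem_span (a : Fin n → F) (G : SkewPoly δ) :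
    linearize δ a G ∈ Submodule.span F (Set.range (opWord δ a)) := by
  induction G using induction_on with
  | zero => simp
  | add G H hG hH => rw [_root_.map_add]; exact add_mem hG hH
  | mono m c =>
    have h : linearize δ a (monomial δ m c) = c • opWord δ a m := by
      apply AddMonoid.End.ext
      intro b
      rw [linearize_monomial]; rfl
    rw [h]
    exact Submodule.smul_mem _ _ (Submodule.subset_span ⟨m, rfl⟩)

theorem linearize_smul (a : Fin n → F) (c : F) (G : SkewPoly δ) :
    linearize δ a (c • G) = c • linearize δ a G := by
  rw [linearize, sumMap_smul]; rfl

theorem exists_linearize_of_mem_span (a : Fin n → F) {f : AddMonoid.End F}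
    (hf : f ∈ Submodule.span F (Set.range (opWord δ a))) : ∃ G, linearize δ a G = f := by
  induction hf using Submodule.span_induction with
  | mem f hf =>
    obtain ⟨m, rfl⟩ := hf
    refine ⟨monomial δ m 1, ?_⟩
    apply AddMonoid.End.ext
    intro b
    simp [linearize_monomial]
  | zero => exact ⟨0, by simp⟩
  | add f g _ _ hf hg =>
    obtain ⟨G, rfl⟩ := hf
    obtain ⟨H, rfl⟩ := hg
    exact ⟨G + H, by simp⟩
  | smul c f _ hf =>
    obtain ⟨G, rfl⟩ := hf
    exact ⟨c • G, linearize_smul δ a c G⟩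

/-- The ring `F[𝒟_a]` of linearized polynomials: the left vector space over `F` generated by the
operators `𝒟_a^𝔪`, with composition as product. -/
def linPoly (a : Fin n → F) : Subring (AddMonoid.End F) where
  carrier := Submodule.span F (Set.range (opWord δ a))
  zero_mem' := Submodule.zero_mem _
  add_mem' := Submodule.add_mem _
  neg_mem' := Submodule.neg_mem _
  one_mem' := Submodule.subset_span ⟨1, _root_.map_one _⟩
  mul_mem' {f g} hf hg := by
    obtain ⟨G, rfl⟩ := exists_linearize_of_mem_span δ a hf
    obtain ⟨H, rfl⟩ := exists_linearize_of_mem_span δ a hg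
    rw [← linearize_mul]
    exact linearize_mem_span δ a _

instance (a : Fin n → F) : Module F (linPoly δ a) :=
  inferInstanceAs (Module F (Submodule.span F (Set.range (opWord δ a))))

/-- `F[𝒟_a]` is a left `F`-algebra. -/
instance (a : Fin n → F) : IsScalarTower F (linPoly δ a) (linPoly δ a) := ⟨fun _ _ _ => rfl⟩

/-- `F[x; σ, δ] / I(𝒞(a))` is a left `F`-algebra. -/
instance (a : Fin n → F) :
    IsScalarTower F (SkewPoly δ ⧸ vanishingIdeal δ (conjClass δ a))
      (SkewPoly δ ⧸ vanishingIdeal δ (conjClass δ a)) :=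
  ⟨fun c x y => by
    obtain ⟨G, rfl⟩ := Ideal.Quotient.mk_surjective x
    obtain ⟨H, rfl⟩ := Ideal.Quotient.mk_surjective y
    exact congrArg (Ideal.Quotient.mk (vanishingIdeal δ (conjClass δ a)))
      (smul_mul_assoc c G H)⟩

/-- The centralizer `K_a = {β ∈ F | 𝒟_a(β) = a β}`, a division subring of `F`. -/
def centralizer (a : Fin n → F) : Subfield F :=
  have key : ∀ {c b : F}, (∀ i, opD δ a i b = a i * b) → ∀ i,
      opD δ a i (c * b) = opD δ a i c * b := by
    intro c b hb i
    rw [opD_mul, opD_apply, add_mul, Finset.sum_mul]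
    simp [hb, mul_assoc]
  { carrier := {b | ∀ i, opD δ a i b = a i * b}
    zero_mem' := fun i => by simp
    one_mem' := fun i => by simp [opD_one]
    add_mem' := fun hb hc i => by simp [hb i, hc i, mul_add]
    neg_mem' := fun hb i => by simp [hb i]
    mul_mem' := fun hb hc i => by rw [key hc, hb i, mul_assoc]
    inv_mem' := fun b hb i => by
      by_cases h0 : b = 0
      · simp [h0]
      · have h := key (c := b⁻¹) hb i
        rw [inv_mul_cancel₀ h0, opD_one] at h
        rw [h, mul_assoc, mul_inv_cancel₀ h0, mul_one] }

end SkewPoly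

section MatrixProduct

variable {F : Type*} [DivisionRing F] {K : Subfield F} {M : ℕ}

/-- `F` as a right vector space over a division subring `K`: `c ∈ K` acts by `x ↦ x c`. -/
instance Subfield.rightModule {F : Type*} [DivisionRing F] (K : Subfield F) : Module (Kᵐᵒᵖ) F :=
  Module.compHom F (K.subtype.op)

/-- The matrix-representation map `μ_β : F^M → K^{M × M}` of an ordered right basis `β`: the `j`-th
column of `μ_β(x)` consists of the coordinates of `x_j`, that is, `x_j = ∑ i, β_i μ_β(x)_{i,j}`. -/
def matRep (β : Module.Basis (Fin M) (Kᵐᵒᵖ) F) : (Fin M → F) ≃+ Matrix (Fin M) (Fin M) K where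
  toFun x := Matrix.of fun i j => (β.repr (x j) i).unop
  invFun A := fun j => ∑ i, β i * (A i j : F)
  left_inv x := by
    funext j
    exact β.sum_repr (x j)
  right_inv A := by
    ext i j
    have h : ∑ k, β k * (A k j : F) = ∑ k, MulOpposite.op (A k j) • β k := rfl
    simp only [Matrix.of_apply, h, β.repr_sum_self]
    simp
  map_add' x y := by
    ext i j
    simp

/-- The vectors `F^M`, to be equipped with the matrix product with respect to `β`. -/
def MatVec (_β : Module.Basis (Fin M) (Kᵐᵒᵖ) F) : Type _ := Fin M → F

namespace MatVec

variable (β : Module.Basis (Fin M) (Kᵐᵒᵖ) F)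

instance : AddCommGroup (MatVec β) := inferInstanceAs (AddCommGroup (Fin M → F))

instance : Module F (MatVec β) := inferInstanceAs (Module F (Fin M → F))

/-- The matrix-representation map, on `MatVec β`. -/
def toMatrix : MatVec β ≃+ Matrix (Fin M) (Fin M) K := matRep β

/-- The matrix product `x ⋆ y = μ_β⁻¹(μ_β(x) μ_β(y))`. -/
instance : Mul (MatVec β) := ⟨fun x y => (toMatrix β).symm (toMatrix β x * toMatrix β y)⟩

instance : One (MatVec β) := ⟨(toMatrix β).symm 1⟩

theorem mul_def (x y : MatVec β) :
    x * y = (toMatrix β).symm (toMatrix β x * toMatrix β y) := rfl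

theorem one_def : (1 : MatVec β) = (toMatrix β).symm 1 := rfl

instance : Ring (MatVec β) :=
  { (inferInstance : AddCommGroup (MatVec β)) with
    mul := (· * ·)
    one := 1
    left_distrib := fun x y z => by simp [mul_def, mul_add]
    right_distrib := fun x y z => by simp [mul_def, add_mul]
    zero_mul := fun x => by simp [mul_def]
    mul_zero := fun x => by simp [mul_def]
    mul_assoc := fun x y z => by simp [mul_def, mul_assoc]
    one_mul := fun x => by simp [mul_def, one_def]
    mul_one := fun x => by simp [mul_def, one_def] }

theorem mul_apply (x y : MatVec β) (j : Fin M) :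
    (x * y) j = ∑ k, x k * (toMatrix β y k j : F) := by
  have hx : ∀ k, x k = ∑ i, β i * (toMatrix β x i k : F) := fun k =>
    (congrFun ((matRep β).symm_apply_apply x) k).symm
  have h : (x * y) j = ∑ i, β i * (((toMatrix β x * toMatrix β y) i j : K) : F) := rfl
  rw [h]
  simp only [hx, Matrix.mul_apply, Finset.sum_mul]
  rw [Finset.sum_comm]
  simp [Finset.mul_sum, mul_assoc]

/-- `F^M` with the matrix product is a left `F`-algebra. -/
instance : IsScalarTower F (MatVec β) (MatVec β) :=
  ⟨fun c x y => by
    funext j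
    have h : ∀ (z : MatVec β) (k : Fin M), (c • z) k = c * z k := fun _ _ => rfl
    simp [h, mul_apply, Finset.mul_sum, mul_assoc]⟩

end MatVec

end MatrixProduct

/-- The linearized evaluation map `E^L_β : F[𝒟_a] → F^M`, `f ↦ (f(β_1), …, f(β_M))`. -/
def SkewPoly.linEval {F : Type*} [DivisionRing F] {n : ℕ} {σ : F →+* Matrix (Fin n) (Fin n) F}
    (δ : SkewDerivation σ) (a : Fin n → F) {M : ℕ}
    (β : Module.Basis (Fin M) (SkewPoly.centralizer δ a)ᵐᵒᵖ F)
    (f : SkewPoly.linPoly δ a) : MatVec β :=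
  fun j => (f : AddMonoid.End F) (β j)

end

namespace SkewPoly

variable {F : Type*} [DivisionRing F] {n : ℕ} {σ : F →+* Matrix (Fin n) (Fin n) F}
  (δ : SkewDerivation σ) (a : Fin n → F)

/-! The map `G ↦ G^{𝒟_a}` is a ring morphism onto `F[𝒟_a]`. Since `G(𝒟_a(b) b⁻¹) b = G^{𝒟_a}(b)` for
`b ≠ 0`, its kernel is `I(𝒞(a))`, so the quotient is a ring of operators on `F`.

These operators make `F` a simple module, because they include all left multiplications by elements
of `F`. For the same reason an endomorphism `g` of this module is right multiplication by `g 1`;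
commuting with the `𝒟_a^{x_i}` then forces `g 1 ∈ K_a`. Jacobson density now says that every right
`K_a`-linear map agrees on any finite set with an operator in `F[𝒟_a]` (`exists_linPoly_eqOn`).

With a finite right basis, evaluation on the basis is therefore surjective, and it is injective
because operators are right `K_a`-linear. Thus `F[𝒟_a]` is the full ring of right `K_a`-linear maps.
The `j`-th column of the matrix of `f` holds the coordinates of `f(β_j)`, so composition becomes the
product `⋆`, that is, matrix multiplication. Simplicity is inherited from a matrix ring of positive
size over a division ring. -/

/-! ### The quotient as a ring of operators. -/

theorem mem_centralizer {b : F} : b ∈ centralizer δ a ↔ ∀ i, opD δ a i b = a i * b := Iff.rfl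

theorem linearize_mem_linPoly (G : SkewPoly δ) : linearize δ a G ∈ linPoly δ a :=
  linearize_mem_span δ a G

theorem exists_linearize_eq (f : linPoly δ a) :
    ∃ G, linearize δ a G = (f : AddMonoid.End F) :=
  exists_linearize_of_mem_span δ a f.2

/-- The ring morphism `G ↦ G^{𝒟_a}` from `F[x; σ, δ]` onto `F[𝒟_a]`. -/
noncomputable def linearizeHom : SkewPoly δ →+* linPoly δ a where
  toFun G := ⟨linearize δ a G, linearize_mem_linPoly δ a G⟩
  map_zero' := Subtype.ext (_root_.map_zero _)
  map_one' := Subtype.ext <| AddMonoid.End.ext _ <| by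
    intro b
    simpa [C, one_def] using linearize_C δ a 1 b
  map_add' G H := Subtype.ext (_root_.map_add _ G H)
  map_mul' G H := Subtype.ext (linearize_mul δ a G H)

theorem coe_linearizeHom (G : SkewPoly δ) :
    (linearizeHom δ a G : AddMonoid.End F) = linearize δ a G := rfl

theorem linearizeHom_surjective : Function.Surjective (linearizeHom δ a) := fun f =>
  (exists_linearize_eq δ a f).imp fun _ h => Subtype.ext h

/-- An operator is zero exactly when it kills every `b ≠ 0`, and its value at `b` is, up to the
factor `b`, the evaluation of `G` at the conjugate of `a` by `b`. -/
theorem ker_linearizeHom :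
    RingHom.ker (linearizeHom δ a) = vanishingIdeal δ (conjClass δ a) := by
  ext G
  rw [mem_vanishingIdeal_conjClass, RingHom.mem_ker, Subtype.ext_iff]
  rfl

/-- The isomorphism `F[x; σ, δ] / I(𝒞(a)) ≃ F[𝒟_a]`. -/
noncomputable def quotientEquiv : (SkewPoly δ ⧸ vanishingIdeal δ (conjClass δ a)) ≃+* linPoly δ a :=
  (Ideal.quotEquivOfEq (ker_linearizeHom δ a).symm).trans
    (RingHom.quotientKerEquivOfSurjective (linearizeHom_surjective δ a))

theorem quotientEquiv_smul (c : F)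
    (x : SkewPoly δ ⧸ vanishingIdeal δ (conjClass δ a)) :
    quotientEquiv δ a (c • x) = c • quotientEquiv δ a x := by
  obtain ⟨G, rfl⟩ := Ideal.Quotient.mk_surjective x
  exact Subtype.ext (linearize_smul δ a c G)

/-! ### Right linearity over `K_a`. -/

/-- In the twisted Leibniz rule for `c * k` each `𝒟_a^{x_j}(k)` equals `a_j k`, so `k` factors out
on the right. -/
theorem opD_mul_centralizer (i : Fin n) (c : F) {k : F} (hk : k ∈ centralizer δ a) :
    opD δ a i (c * k) = opD δ a i c * k := by
  rw [opD_mul, opD_apply, add_mul, Finset.sum_mul]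
  simp [(mem_centralizer δ a).1 hk, mul_assoc]

theorem opWord_mul_centralizer (m : FreeMonoid (Fin n)) (c : F) {k : F}
    (hk : k ∈ centralizer δ a) : opWord δ a m (c * k) = opWord δ a m c * k := by
  induction m using FreeMonoid.inductionOn' with
  | one => simp
  | of_mul i m ih =>
    simp only [opWord, _root_.map_mul, FreeMonoid.lift_eval_of, addEnd_mul_apply] at *
    rw [ih, opD_mul_centralizer δ a i _ hk]

/-- The operators in `F[𝒟_a]` are right linear over `K_a`. -/
theorem linPoly_apply_mul_centralizer (f : linPoly δ a) (c : F) {k : F}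
    (hk : k ∈ centralizer δ a) :
    (f : AddMonoid.End F) (c * k) = (f : AddMonoid.End F) c * k := by
  obtain ⟨G, hG⟩ := exists_linearize_eq δ a f
  simp only [← hG, linearize_apply, Finsupp.sum, Finset.sum_mul, mul_assoc,
    opWord_mul_centralizer δ a _ _ hk]

/-! ### `F` as a simple module, and density. -/

theorem linPoly_smul_def (f : linPoly δ a) (v : F) : f • v = (f : AddMonoid.End F) v := rfl

theorem linearizeHom_C_smul (c v : F) : linearizeHom δ a (C δ c) • v = c * v :=
  linearize_C δ a c v

theorem linearizeHom_X_smul (i : Fin n) (v : F) :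
    linearizeHom δ a (X δ i) • v = opD δ a i v := by
  rw [linPoly_smul_def, coe_linearizeHom, linearize_X]

/-- `F` is a simple left module over `F[𝒟_a]`. -/
instance : IsSimpleModule (linPoly δ a) F :=
  isSimpleModule_iff_toSpanSingleton_surjective.2 ⟨inferInstance, fun v hv w =>
    -- Left multiplication by `w v⁻¹` carries `v` to `w`.
    ⟨linearizeHom δ a (C δ (w * v⁻¹)), by
      rw [LinearMap.toSpanSingleton_apply, linearizeHom_C_smul, inv_mul_cancel_right₀ hv]⟩⟩

/-- Left multiplication by `v` is one of the scalars of the module, and it sends `1` to `v`. -/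
theorem moduleEnd_apply (g : Module.End (linPoly δ a) F) (v : F) : g v = v * g 1 := by
  have h := g.map_smul (linearizeHom δ a (C δ v)) 1
  rwa [linearizeHom_C_smul, linearizeHom_C_smul, mul_one] at h

/-- The endomorphisms of the `F[𝒟_a]`-module `F` are the right multiplications by elements
of `K_a`. -/
theorem moduleEnd_one_mem_centralizer (g : Module.End (linPoly δ a) F) :
    g 1 ∈ centralizer δ a := by
  intro i
  -- Commuting with `𝒟_a^{x_i}` is tested at `1`, where `𝒟_a^{x_i}(1) = a_i`.
  have h := g.map_smul (linearizeHom δ a (X δ i)) 1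
  rw [linearizeHom_X_smul, linearizeHom_X_smul, opD_one, moduleEnd_apply] at h
  exact h.symm

/-- A map that is right linear over `K_a` agrees on every finite set with an operator in
`F[𝒟_a]`. -/
theorem exists_linPoly_eqOn (h : F →ₗ[(centralizer δ a)ᵐᵒᵖ] F) (s : Finset F) :
    ∃ f : linPoly δ a, ∀ v ∈ s, (f : AddMonoid.End F) v = h v := by
  -- Density applies to maps commuting with all module endomorphisms. Each such endomorphism is
  -- right multiplication by an element of `K_a`, so right `K_a`-linearity of `h` suffices.
  let h' : Module.End (Module.End (linPoly δ a) F) F :=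
    { toFun := h
      map_add' := h.map_add
      map_smul' := fun g v => by
        have e := h.map_smul (MulOpposite.op ⟨g 1, moduleEnd_one_mem_centralizer δ a g⟩) v
        change h (v * g 1) = h v * g 1 at e
        change h (g v) = g (h v)
        rw [moduleEnd_apply δ a g v, moduleEnd_apply δ a g (h v), e] }
  obtain ⟨f, hf⟩ := jacobson_density (R := linPoly δ a) h' s
  exact ⟨f, fun v hv => (hf v hv).symm⟩

/-! ### Evaluation on a right basis. -/

variable {M : ℕ} (β : Module.Basis (Fin M) (centralizer δ a)ᵐᵒᵖ F)

theorem linEval_apply (f : linPoly δ a) (j : Fin M) :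
    linEval δ a β f j = (f : AddMonoid.End F) (β j) := rfl

theorem linPoly_apply_sum (f : linPoly δ a) (k : Fin M → centralizer δ a) :
    (f : AddMonoid.End F) (∑ i, β i * (k i : F)) = ∑ i, linEval δ a β f i * (k i : F) := by
  rw [_root_.map_sum]
  exact Finset.sum_congr rfl fun i _ => linPoly_apply_mul_centralizer δ a f (β i) (k i).2

theorem sum_basis_toMatrix {K : Subfield F} (γ : Module.Basis (Fin M) Kᵐᵒᵖ F) (x : MatVec γ)
    (j : Fin M) : ∑ i, γ i * (MatVec.toMatrix γ x i j : F) = x j :=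
  congrFun ((matRep γ).symm_apply_apply x) j

/-- Expanding `g(β_j)` in the basis and applying the right linear `f` gives `∑ i, f(β_i)
μ_β(g(β))_{i,j}`, which is the `j`-th entry of the `⋆` product. -/
theorem linEval_mul (f g : linPoly δ a) :
    linEval δ a β (f * g) = linEval δ a β f * linEval δ a β g := by
  funext j
  rw [MatVec.mul_apply, ← linPoly_apply_sum, sum_basis_toMatrix]
  rfl

theorem linEval_injective : Function.Injective (linEval δ a β) := by
  intro f g h
  refine Subtype.ext <| AddMonoid.End.ext _ fun v => ?_
  have hv : ∑ i, β i * ((β.repr v i).unop : F) = v := β.sum_repr v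
  rw [← hv, linPoly_apply_sum, linPoly_apply_sum, h]

theorem linEval_surjective : Function.Surjective (linEval δ a β) := by
  classical
  intro x
  -- Density is applied to the right linear map with `β_j ↦ x_j` on the finite set of basis vectors.
  -- The argument `ℕ` only names a semiring whose action commutes with that of `K_aᵐᵒᵖ`.
  obtain ⟨f, hf⟩ := exists_linPoly_eqOn δ a (β.constr ℕ x) (Finset.univ.image β)
  refine ⟨f, funext fun j => ?_⟩
  rw [linEval_apply, hf _ (Finset.mem_image_of_mem _ (Finset.mem_univ j))]
  exact β.constr_basis ℕ x j

/-- The linearized evaluation map as a ring isomorphism onto `F^M` with the matrix product. -/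
noncomputable def linEvalEquiv : linPoly δ a ≃+* MatVec β :=
  { Equiv.ofBijective (linEval δ a β) ⟨linEval_injective δ a β, linEval_surjective δ a β⟩ with
    map_mul' := linEval_mul δ a β
    map_add' := fun _ _ => rfl }

end SkewPoly

/-! ### Matrices and simplicity. -/

/-- The matrix-representation map as a ring isomorphism. -/
noncomputable def MatVec.toMatrixEquiv {F : Type*} [DivisionRing F] {K : Subfield F} {M : ℕ}
    (β : Module.Basis (Fin M) (Kᵐᵒᵖ) F) : MatVec β ≃+* Matrix (Fin M) (Fin M) K :=
  { MatVec.toMatrix β with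
    map_mul' := fun _ _ => (MatVec.toMatrix β).apply_symm_apply _ }

theorem RingEquiv.isSimpleRing {R S : Type*} [Ring R] [Ring S] (e : R ≃+* S) [IsSimpleRing S] :
    IsSimpleRing R :=
  ⟨e.mapTwoSidedIdeal.isSimpleOrder⟩

theorem mainTheorem5 {F : Type*} [DivisionRing F] {n : ℕ}
    (σ : F →+* Matrix (Fin n) (Fin n) F) (δ : SkewDerivation σ) (a : Fin n → F) {M : ℕ}
    (β : Module.Basis (Fin M) (SkewPoly.centralizer δ a)ᵐᵒᵖ F) :
    (∃ (φ : (SkewPoly δ ⧸ SkewPoly.vanishingIdeal δ (SkewPoly.conjClass δ a)) ≃+*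
          SkewPoly.linPoly δ a)
        (E : SkewPoly.linPoly δ a ≃+* MatVec β)
        (μ : MatVec β ≃+* Matrix (Fin M) (Fin M) (SkewPoly.centralizer δ a)),
      (∀ G : SkewPoly δ,
        (φ (Ideal.Quotient.mk (SkewPoly.vanishingIdeal δ (SkewPoly.conjClass δ a)) G) :
          AddMonoid.End F) = SkewPoly.linearize δ a G) ∧
      (∀ (c : F) (x : SkewPoly δ ⧸ SkewPoly.vanishingIdeal δ (SkewPoly.conjClass δ a)),
        φ (c • x) = c • φ x) ∧
      (∀ f : SkewPoly.linPoly δ a, E f = SkewPoly.linEval δ a β f) ∧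
      (∀ (c : F) (f : SkewPoly.linPoly δ a), E (c • f) = c • E f) ∧
      (∀ x : MatVec β, μ x = matRep β x) ∧
      (∀ f : SkewPoly.linPoly δ a,
        (E.trans μ) f = matRep β (SkewPoly.linEval δ a β f))) ∧
    IsSimpleRing (SkewPoly δ ⧸ SkewPoly.vanishingIdeal δ (SkewPoly.conjClass δ a)) := by
  let e := ((SkewPoly.quotientEquiv δ a).trans (SkewPoly.linEvalEquiv δ a β)).trans
    (MatVec.toMatrixEquiv β)
  refine ⟨⟨SkewPoly.quotientEquiv δ a, SkewPoly.linEvalEquiv δ a β, MatVec.toMatrixEquiv β,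
    fun _ => rfl, SkewPoly.quotientEquiv_smul δ a, fun _ => rfl, fun _ _ => rfl, fun _ => rfl,
    fun _ => rfl⟩, ?_⟩
  -- `F ≠ 0` forces `M > 0`; the ring of empty matrices is zero, hence not simple.
  have : Nonempty (Fin M) := β.index_nonempty
  exact e.isSimpleRing
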